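/- Let $k$ be a finite field, $F = k(t)$, and let $f \in k[t]$ be a monic irreducible polynomial of degree $d$, with associated place $p$ of $F$. Let $\mathcal{O}_{\{p,\infty\}} \subset F$ be the ring of elements having poles at most at $p$ and at the place $\infty$, whose valuation is $\nu_\infty(a/b) = \deg b - \deg a$. Let $\Pi := \mathrm{PGL}_2(\mathcal{O}_{\{p,\infty\}})$, a subgroup of $\mathrm{PGL}_2(F)$. Let $X$ and $Y$ be the Bruhat–Tits trees of $\mathrm{PGL}_2(F_p)$ and $\mathrm{PGL}_2(F_\infty)$, where $F_p$ and $F_\infty$ are the completions of $F$ at $p$ and $\infty$. Their vertices are the homothety classes of rank-two lattices over the respective valuation ring. Two vertices are adjacent if they have representatives $L' \subset L$ with $L/L'$ isomorphic to the residue field. Let $\mathrm{PGL}_2(F)$ act on both trees through its action from the left on lattices. Let $x_0$ be the vertex of $X$ given by the standard lattice and, for an integer $i \ge 0$, let $y_i$ be the vertex of $Y$ given by the lattice spanned by the columns of $\begin{pmatrix} t^i & 0 \\ 0 & 1 \end{pmatrix}$. Then for all integers $m, n \ge 0$ the set of all $h \in \Pi$ such that $h(x_0)$ is adjacent to $x_0$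 in $X$ and $h(y_m) = y_n$ equals the set $\Upsilon_{n,m}$ of all elements of $\mathrm{PGL}_2(F)$ represented by a matrix $\begin{pmatrix} \alpha & \beta \\ \gamma & \delta \end{pmatrix}$ with $\alpha, \beta, \gamma, \delta \in k[t]$ such that $$\deg\alpha \le \tfrac{d+n-m}{2}, \quad \deg\beta \le \tfrac{d+n+m}{2}, \quad \deg\gamma \le \tfrac{d-n-m}{2}, \quad \deg\delta \le \tfrac{d-n+m}{2},$$ and $\alpha\delta - \beta\gamma = \lambda f$ for some $\lambda \in k^*$. Here $\deg 0 = -\infty$, and the bounds are rational numbers that need not be integers. -/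

import Mathlib

open Polynomial IsDedekindDomain
open scoped MatrixGroups

namespace BruhatTits

variable {K Γ₀ : Type*} [Field K] [LinearOrderedCommGroupWithZero Γ₀]

/-- The lattices in `K²`: finitely generated `𝒪`-submodules of `K²` that span `K²` over `K`,
where `𝒪` is the valuation ring of `v`. -/
def Lattice (v : Valuation K Γ₀) : Type _ :=
  {L : Submodule v.valuationSubring (Fin 2 → K) // Submodule.IsLattice K L}

/-- The matrix `g`, acting on column vectors, as an `𝒪`-linear endomorphism of `K²`. -/
noncomputable def mulVecO (v : Valuation K Γ₀) (g : GL (Fin 2) K) :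
    (Fin 2 → K) →ₗ[v.valuationSubring] (Fin 2 → K) :=
  (Matrix.mulVecLin (g : Matrix (Fin 2) (Fin 2) K)).restrictScalars v.valuationSubring

/-- The left action of `GL₂(K)` on lattices, `(g, L) ↦ gL`. -/
noncomputable instance (v : Valuation K Γ₀) : MulAction (GL (Fin 2) K) (Lattice v) where
  smul g L := ⟨L.1.map (mulVecO v g), by
    obtain ⟨L, hL⟩ := L
    refine ⟨hL.fg.map _, ?_⟩
    have hs : ((L.map (mulVecO v g) : Submodule v.valuationSubring (Fin 2 → K)) :
        Set (Fin 2 → K)) = Matrix.mulVecLin (g : Matrix (Fin 2) (Fin 2) K) '' L := rfl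
    rw [hs, Submodule.span_image, hL.span_eq_top, Submodule.map_top, LinearMap.range_eq_top]
    intro x
    exact ⟨((g⁻¹ : GL (Fin 2) K) : Matrix (Fin 2) (Fin 2) K).mulVec x, by
      simp only [Matrix.mulVecLin_apply, Matrix.mulVec_mulVec, ← Units.val_mul, mul_inv_cancel,
        Units.val_one, Matrix.one_mulVec]⟩⟩
  one_smul L := Subtype.ext <| by
    have h : mulVecO v (1 : GL (Fin 2) K) = LinearMap.id := by
      ext x; simp [mulVecO]
    change L.1.map (mulVecO v 1) = L.1
    rw [h, Submodule.map_id]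
  mul_smul g h L := Subtype.ext <| by
    have e : mulVecO v (g * h) = (mulVecO v g).comp (mulVecO v h) := by
      ext x; simp [mulVecO]
    change L.1.map (mulVecO v (g * h)) = (L.1.map (mulVecO v h)).map (mulVecO v g)
    rw [e, Submodule.map_comp]

theorem coe_smul (v : Valuation K Γ₀) (g : GL (Fin 2) K) (L : Lattice v) :
    (g • L).1 = L.1.map (mulVecO v g) := rfl

/-- Two lattices are homothetic if `L' = aL` for some `a ∈ Kˣ` (the scalar matrix of `a`
acts on lattices as multiplication by `a`). -/
def homothety (v : Valuation K Γ₀) : Setoid (Lattice v) where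
  r L L' := ∃ a : Kˣ, Matrix.GeneralLinearGroup.scalar (Fin 2) a • L = L'
  iseqv :=
    { refl := fun L => ⟨1, by rw [map_one, one_smul]⟩
      symm := by
        rintro L _ ⟨a, rfl⟩
        exact ⟨a⁻¹, by rw [map_inv, inv_smul_smul]⟩
      trans := by
        rintro L _ _ ⟨a, rfl⟩ ⟨b, rfl⟩
        exact ⟨b * a, by rw [map_mul, mul_smul]⟩ }

/-- The vertices of the Bruhat-Tits tree of `PGL₂(K)`: homothety classes of lattices in `K²`. -/
def Vertex (v : Valuation K Γ₀) : Type _ := Quotient (homothety v)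

/-- The homothety class of a lattice. -/
def Vertex.mk {v : Valuation K Γ₀} (L : Lattice v) : Vertex v := Quotient.mk (homothety v) L

theorem scalar_smul_comm (v : Valuation K Γ₀) (a : Kˣ) (g : GL (Fin 2) K) (L : Lattice v) :
    Matrix.GeneralLinearGroup.scalar (Fin 2) a • g • L =
      g • Matrix.GeneralLinearGroup.scalar (Fin 2) a • L := by
  have h : Matrix.GeneralLinearGroup.scalar (Fin 2) a * g =
      g * Matrix.GeneralLinearGroup.scalar (Fin 2) a := by
    apply Units.ext
    exact (Matrix.scalar_commute (n := Fin 2) (a : K) (fun _ => mul_comm _ _) g.1).eq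
  rw [← mul_smul, ← mul_smul, h]

/-- The induced action of `GL₂(K)` on vertices. -/
noncomputable instance (v : Valuation K Γ₀) : MulAction (GL (Fin 2) K) (Vertex v) where
  smul g := Quotient.map (g • ·) <| by
    rintro L _ ⟨a, rfl⟩
    exact ⟨a, scalar_smul_comm v a g L⟩
  one_smul x := by
    obtain ⟨L, rfl⟩ := Quotient.exists_rep x
    exact congrArg Vertex.mk (one_smul (GL (Fin 2) K) L)
  mul_smul g h x := by
    obtain ⟨L, rfl⟩ := Quotient.exists_rep x
    exact congrArg Vertex.mk (mul_smul g h L)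

theorem smul_mk {v : Valuation K Γ₀} (g : GL (Fin 2) K) (L : Lattice v) :
    g • Vertex.mk L = Vertex.mk (g • L) := rfl

/-- The action of `PGL₂(K)` on the vertices of its Bruhat-Tits tree. -/
noncomputable instance (v : Valuation K Γ₀) : MulAction PGL(2, K) (Vertex v) :=
  Matrix.ProjGenLinGroup.mulActionOfGL <| by
    intro a x
    obtain ⟨L, rfl⟩ := Quotient.exists_rep x
    exact (Quotient.sound (s := homothety v) ⟨a, rfl⟩).symm

/-- The Bruhat-Tits tree: two distinct vertices are joined by an edge if they have
representatives `L' ⊆ L` with `L/L'` isomorphic to the residue field of `𝒪` as an `𝒪`-module. -/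
def tree (v : Valuation K Γ₀) : SimpleGraph (Vertex v) :=
  SimpleGraph.fromRel fun x y => ∃ L L' : Lattice v, Vertex.mk L = x ∧ Vertex.mk L' = y ∧
    L'.1 ≤ L.1 ∧ Nonempty ((L.1 ⧸ L'.1.submoduleOf L.1) ≃ₗ[v.valuationSubring]
      IsLocalRing.ResidueField v.valuationSubring)

/-- The lattice spanned by the columns of an invertible matrix. -/
def columnLattice (v : Valuation K Γ₀) (M : GL (Fin 2) K) : Lattice v :=
  ⟨Submodule.span v.valuationSubring (Set.range (M : Matrix (Fin 2) (Fin 2) K).col), by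
    refine ⟨Submodule.fg_span (Set.finite_range _), ?_⟩
    rw [Submodule.span_span_of_tower, ← Matrix.range_mulVecLin, LinearMap.range_eq_top]
    intro x
    exact ⟨((M⁻¹ : GL (Fin 2) K) : Matrix (Fin 2) (Fin 2) K).mulVec x, by
      simp only [Matrix.mulVecLin_apply, Matrix.mulVec_mulVec, ← Units.val_mul, mul_inv_cancel,
        Units.val_one, Matrix.one_mulVec]⟩⟩

/-- The vertex given by a matrix: the class of the lattice spanned by its columns. -/
def Vertex.ofColumns (v : Valuation K Γ₀) (M : GL (Fin 2) K) : Vertex v :=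
  Vertex.mk (columnLattice v M)

end BruhatTits

namespace RationalFunctionField

open BruhatTits

variable (k : Type*) [Field k]

/-- The place of `k(t)` corresponding to an irreducible polynomial `f`. -/
noncomputable def place {k : Type*} [Field k] (f : k[X]) (hf : Irreducible f) :
    HeightOneSpectrum k[X] where
  asIdeal := Ideal.span {f}
  isPrime := (Ideal.span_singleton_prime hf.ne_zero).2 hf.prime
  ne_bot := by simpa using hf.ne_zero

/-- The valuation of `k(t)` at the place of `f`, written multiplicatively. -/
noncomputable abbrev valP {k : Type*} [Field k] (f : k[X]) (hf : Irreducible f) :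
    Valuation (RatFunc k) (WithZero (Multiplicative ℤ)) :=
  (place f hf).valuation (RatFunc k)

open scoped Classical in
/-- The valuation of `k(t)` at the place `∞`, written multiplicatively. -/
noncomputable abbrev valInfty : Valuation (RatFunc k) (WithZero (Multiplicative ℤ)) :=
  RatFunc.inftyValuation k

variable {k}

/-- The embedding of `k(t)` into its completion with respect to a valuation. -/
noncomputable def toCompletion (w : Valuation (RatFunc k) (WithZero (Multiplicative ℤ))) :
    RatFunc k →+* w.Completion :=
  UniformSpace.Completion.coeRingHom.comp (WithVal.equiv w).symm.toRingHom

/-- The extension of a valuation of `k(t)` to the completion. -/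
noncomputable abbrev completedVal (w : Valuation (RatFunc k) (WithZero (Multiplicative ℤ))) :
    Valuation w.Completion (WithZero (Multiplicative ℤ)) :=
  Valued.v

/-- The action of `PGL₂(k(t))` on the vertices of the Bruhat-Tits tree of the completion of
`k(t)` with respect to `w`. -/
noncomputable instance (w : Valuation (RatFunc k) (WithZero (Multiplicative ℤ))) :
    MulAction PGL(2, RatFunc k) (Vertex (completedVal w)) :=
  MulAction.compHom _ (Matrix.ProjGenLinGroup.map (n := Fin 2) (toCompletion w))

/-- The vertex given by the columns of a matrix over `k(t)`. -/
noncomputable def vertexOf (w : Valuation (RatFunc k) (WithZero (Multiplicative ℤ)))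
    (M : GL (Fin 2) (RatFunc k)) : Vertex (completedVal w) :=
  Vertex.ofColumns (completedVal w) (Matrix.GeneralLinearGroup.map (toCompletion w) M)

/-- The tree `X`: the Bruhat-Tits tree of `PGL₂` of the completion of `k(t)` at the place of
`f`. -/
noncomputable def treeX (f : k[X]) (hf : Irreducible f) :
    SimpleGraph (Vertex (completedVal (valP f hf))) :=
  tree (completedVal (valP f hf))

/-- The vertex `x₀` of `X`, given by the identity matrix. -/
noncomputable def xVertex (f : k[X]) (hf : Irreducible f) : Vertex (completedVal (valP f hf)) :=
  vertexOf (valP f hf) 1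

/-- The vertex `y_i` of the Bruhat-Tits tree `Y` of `PGL₂` of the completion of `k(t)` at `∞`,
given by the matrix `diag(t^i, 1)`. -/
noncomputable def yVertex (k : Type*) [Field k] (i : ℕ) : Vertex (completedVal (valInfty k)) :=
  vertexOf (valInfty k) <| Matrix.GeneralLinearGroup.mkOfDetNeZero
    !![(RatFunc.X : RatFunc k) ^ i, 0; 0, 1] (by simp [RatFunc.X_ne_zero])

/-- The ring `𝒪_{p,∞}` of elements of `k(t)` with poles only at the place `p` of `f` and at `∞`.
The places of `k(t)` other than `∞` are the nonzero primes of `k[t]`. -/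
noncomputable abbrev integersPInfty (f : k[X]) (hf : Irreducible f) :
    Subalgebra k[X] (RatFunc k) :=
  ({place f hf} : Set (HeightOneSpectrum k[X])).integer (RatFunc k)

/-- The group `Π = PGL₂(𝒪_{p,∞})` as a subgroup of `PGL₂(k(t))`. -/
noncomputable def arithmeticGroup (f : k[X]) (hf : Irreducible f) :
    Subgroup PGL(2, RatFunc k) :=
  (Matrix.ProjGenLinGroup.map (n := Fin 2)
    (algebraMap (integersPInfty f hf) (RatFunc k))).range

/-- `deg a ≤ c` for a rational bound `c`, with the convention `deg 0 = -∞`. -/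
def DegLE (a : k[X]) (c : ℚ) : Prop := a ≠ 0 → (a.natDegree : ℚ) ≤ c

/-- The set `Υ_{n,m}` of classes in `PGL₂(k(t))` of the matrices with polynomial entries
`α, β, γ, δ` subject to the degree bounds and to `αδ - βγ = λf` with `λ ∈ kˣ`. -/
def Upsilon (f : k[X]) (n m : ℕ) : Set PGL(2, RatFunc k) :=
  {h | ∃ (g : GL (Fin 2) (RatFunc k)) (α β γ δ : k[X]),
    Matrix.ProjGenLinGroup.mk g = h ∧
    (g : Matrix (Fin 2) (Fin 2) (RatFunc k)) =
      (!![α, β; γ, δ] : Matrix (Fin 2) (Fin 2) k[X]).map (algebraMap k[X] (RatFunc k)) ∧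
    DegLE α ((f.natDegree + n - m : ℚ) / 2) ∧ DegLE β ((f.natDegree + n + m : ℚ) / 2) ∧
    DegLE γ ((f.natDegree - n - m : ℚ) / 2) ∧ DegLE δ ((f.natDegree - n + m : ℚ) / 2) ∧
    ∃ c : kˣ, α * δ - β * γ = C (c : k) * f}

end RationalFunctionField

/-! Both tree conditions become conditions on a matrix `g` representing `h`. A vertex is a class of
matrices modulo scalars on one side and integral matrices of unit determinant on the other. Hence
`g` moves the standard vertex to a neighbour iff some scalar multiple of `g` is integral with
determinant a uniformizer (`tree_adj_ofColumns_one_iff`). All conditions on the scalar concern only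
its valuation, so it can be taken in k(t) instead of the completion (`exists_unit_completion_iff`).

At p: an element of Π has a representative that is integral with unit determinant at every finite
place other than p. Scaling by a power of f changes nothing at those places and achieves the
adjacency condition at p. The entries are then integral at all finite places, hence polynomials, and
the determinant has the divisor of f, so it is λf (`exists_polynomial_matrix`). Conversely, λf is a
unit away from p and a uniformizer at p.

At ∞: `h` maps y_m to y_n iff diag(t^n, 1)⁻¹ g diag(t^m, 1), scaled by some c of valuation exp j, is
integral with unit determinant. This gives degree bounds depending on j, together with 2j + d + m =
n (`mk_smul_yVertex_eq_iff`). Eliminating j yields the stated bounds. If d + n - m is odd no such j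
exists, but then no matrix meets the bounds either: one of αδ, βγ has degree at least d, while the
two bounds in each product add up to d, so they are attained and half-integral bounds are excluded
(`exists_shift_iff_degLE`). -/

namespace BruhatTits

variable {K Γ₀ : Type*} [Field K] [LinearOrderedCommGroupWithZero Γ₀]

/-! ### Integral matrices and comparison of column lattices -/

/-- A matrix is integral if its entries lie in the valuation ring. -/
def IsIntegralMatrix (v : Valuation K Γ₀) (A : Matrix (Fin 2) (Fin 2) K) : Prop :=
  ∀ i j, v (A i j) ≤ 1

theorem map_mul_add_mul_le_one (v : Valuation K Γ₀) {a b c d : K} (ha : v a ≤ 1) (hb : v b ≤ 1)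
    (hc : v c ≤ 1) (hd : v d ≤ 1) : v (a * b + c * d) ≤ 1 :=
  v.map_add_le (by rw [map_mul]; exact mul_le_one' ha hb) (by rw [map_mul]; exact mul_le_one' hc hd)

namespace IsIntegralMatrix

variable {v : Valuation K Γ₀} {A : Matrix (Fin 2) (Fin 2) K}

theorem mulVec (hA : IsIntegralMatrix v A) {x : Fin 2 → K} (hx : ∀ i, v (x i) ≤ 1) (i : Fin 2) :
    v ((A.mulVec x) i) ≤ 1 := by
  simp only [Matrix.mulVec, dotProduct, Fin.sum_univ_two]
  exact map_mul_add_mul_le_one v (hA _ _) (hx _) (hA _ _) (hx _)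

theorem det_le_one (hA : IsIntegralMatrix v A) : v A.det ≤ 1 := by
  rw [Matrix.det_fin_two, sub_eq_add_neg, ← neg_mul]
  exact map_mul_add_mul_le_one v (hA _ _) (hA _ _) (by rw [v.map_neg]; exact hA _ _) (hA _ _)

theorem adjugate (hA : IsIntegralMatrix v A) : IsIntegralMatrix v A.adjugate := by
  intro i j
  rw [Matrix.adjugate_fin_two]
  fin_cases i <;> fin_cases j <;> simp <;> exact hA _ _

theorem inv (hA : IsIntegralMatrix v A) (h : v A.det = 1) : IsIntegralMatrix v A⁻¹ := by
  intro i j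
  rw [Matrix.inv_def, Ring.inverse_eq_inv', Matrix.smul_apply, smul_eq_mul, map_mul, map_inv₀, h,
    inv_one, one_mul]
  exact hA.adjugate i j

end IsIntegralMatrix

theorem mulVec_inv_cancel (M : GL (Fin 2) K) (x : Fin 2 → K) :
    (M : Matrix (Fin 2) (Fin 2) K).mulVec
      (((M⁻¹ : GL (Fin 2) K) : Matrix (Fin 2) (Fin 2) K).mulVec x) = x := by
  simp only [Matrix.mulVec_mulVec, ← Units.val_mul, mul_inv_cancel, Units.val_one,
    Matrix.one_mulVec]

theorem inv_mulVec_cancel (M : GL (Fin 2) K) (x : Fin 2 → K) :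
    ((M⁻¹ : GL (Fin 2) K) : Matrix (Fin 2) (Fin 2) K).mulVec
      ((M : Matrix (Fin 2) (Fin 2) K).mulVec x) = x := by
  simp only [Matrix.mulVec_mulVec, ← Units.val_mul, inv_mul_cancel, Units.val_one,
    Matrix.one_mulVec]

theorem mem_columnLattice {v : Valuation K Γ₀} {M : GL (Fin 2) K} {x : Fin 2 → K} :
    x ∈ (columnLattice v M).1 ↔
      ∀ i, v ((((M⁻¹ : GL (Fin 2) K) : Matrix (Fin 2) (Fin 2) K).mulVec x) i) ≤ 1 := by
  have hsum : ∀ c : Fin 2 → v.valuationSubring,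
      ∑ i, c i • (M : Matrix (Fin 2) (Fin 2) K).col i =
        (M : Matrix (Fin 2) (Fin 2) K).mulVec fun i => (c i : K) := by
    intro c
    ext j
    simp [Matrix.mulVec, dotProduct, Fin.sum_univ_two, mul_comm]
    rfl
  change x ∈ Submodule.span v.valuationSubring (Set.range (M : Matrix (Fin 2) (Fin 2) K).col) ↔ _
  rw [Submodule.mem_span_range_iff_exists_fun]
  constructor
  · rintro ⟨c, rfl⟩ i
    rw [hsum, inv_mulVec_cancel]
    exact (c i).2
  · intro h
    refine ⟨fun i => ⟨_, h i⟩, ?_⟩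
    rw [hsum]
    exact mulVec_inv_cancel M x

theorem mulVec_mem_columnLattice {v : Valuation K Γ₀} {M : GL (Fin 2) K} {x : Fin 2 → K} :
    (M : Matrix (Fin 2) (Fin 2) K).mulVec x ∈ (columnLattice v M).1 ↔ ∀ i, v (x i) ≤ 1 := by
  rw [mem_columnLattice, inv_mulVec_cancel]

theorem smul_columnLattice (v : Valuation K Γ₀) (g M : GL (Fin 2) K) :
    g • columnLattice v M = columnLattice v (g * M) := by
  apply Subtype.ext
  ext x
  rw [coe_smul, Submodule.mem_map, mem_columnLattice, mul_inv_rev, Units.val_mul,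
    ← Matrix.mulVec_mulVec, ← mem_columnLattice (M := M)]
  constructor
  · rintro ⟨y, hy, rfl⟩
    change (((g⁻¹ : GL (Fin 2) K) : Matrix (Fin 2) (Fin 2) K).mulVec
      ((g : Matrix (Fin 2) (Fin 2) K).mulVec y)) ∈ _
    rwa [inv_mulVec_cancel]
  · intro h
    exact ⟨_, h, mulVec_inv_cancel g x⟩

theorem smul_ofColumns (v : Valuation K Γ₀) (g M : GL (Fin 2) K) :
    g • Vertex.ofColumns v M = Vertex.ofColumns v (g * M) := by
  rw [Vertex.ofColumns, smul_mk, smul_columnLattice, Vertex.ofColumns]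

theorem columnLattice_le_iff {v : Valuation K Γ₀} {A B : GL (Fin 2) K} :
    (columnLattice v A).1 ≤ (columnLattice v B).1 ↔
      IsIntegralMatrix v (B⁻¹ * A : GL (Fin 2) K).1 := by
  constructor
  · intro h i j
    have h1 := h (mulVec_mem_columnLattice (v := v) (M := A) (x := Pi.single j 1) |>.2 (by
      intro i; by_cases hij : i = j <;> simp [hij]))
    rw [mem_columnLattice, Matrix.mulVec_mulVec, ← Units.val_mul] at h1
    simpa using h1 i
  · intro h x hx
    rw [mem_columnLattice] at hx ⊢
    have := h.mulVec hx
    rwa [Matrix.mulVec_mulVec, ← Units.val_mul, mul_inv_cancel_right] at this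

theorem val_inv_eq (g : GL (Fin 2) K) :
    ((g⁻¹ : GL (Fin 2) K) : Matrix (Fin 2) (Fin 2) K) = (g : Matrix (Fin 2) (Fin 2) K)⁻¹ :=
  Matrix.coe_units_inv g

theorem val_det_inv_mul (A B : GL (Fin 2) K) :
    (B⁻¹ * A : GL (Fin 2) K).1.det = B.1.det⁻¹ * A.1.det := by
  rw [Units.val_mul, Matrix.det_mul, val_inv_eq, Matrix.det_nonsing_inv, Ring.inverse_eq_inv']

theorem val_det_ne_zero (v : Valuation K Γ₀) (A : GL (Fin 2) K) : v A.1.det ≠ 0 :=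
  v.ne_zero_iff.2 A.det_ne_zero

/-- Equal lattices make B⁻¹A and its inverse integral, so both determinants have valuation at most 1
and hence exactly 1. Conversely, the adjugate formula makes the inverse of an integral matrix of
unit determinant integral. -/
theorem columnLattice_eq_iff {v : Valuation K Γ₀} {A B : GL (Fin 2) K} :
    columnLattice v A = columnLattice v B ↔
      IsIntegralMatrix v (B⁻¹ * A : GL (Fin 2) K).1 ∧ v A.1.det = v B.1.det := by
  have hdet : v (B⁻¹ * A : GL (Fin 2) K).1.det = 1 ↔ v A.1.det = v B.1.det := by
    rw [val_det_inv_mul, map_mul, map_inv₀, inv_mul_eq_one₀ (val_det_ne_zero v B), eq_comm]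
  have hinv : (A⁻¹ * B : GL (Fin 2) K) = (B⁻¹ * A : GL (Fin 2) K)⁻¹ := by simp
  constructor
  · intro h
    have h1 := columnLattice_le_iff.1 (le_of_eq (congrArg Subtype.val h))
    have h2 := columnLattice_le_iff.1 (le_of_eq (congrArg Subtype.val h.symm))
    refine ⟨h1, le_antisymm ?_ ?_⟩
    · have := h1.det_le_one
      rw [val_det_inv_mul, map_mul, map_inv₀, inv_mul_le_iff₀
        (zero_lt_iff.2 (val_det_ne_zero v B))] at this
      simpa using this
    · have := h2.det_le_one
      rw [val_det_inv_mul, map_mul, map_inv₀, inv_mul_le_iff₀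
        (zero_lt_iff.2 (val_det_ne_zero v A))] at this
      simpa using this
  · rintro ⟨h1, h2⟩
    refine Subtype.ext (le_antisymm (columnLattice_le_iff.2 h1) (columnLattice_le_iff.2 ?_))
    rw [hinv, val_inv_eq]
    exact h1.inv (hdet.2 h2)

theorem coe_scalar_mul (c : Kˣ) (A : GL (Fin 2) K) :
    (Matrix.GeneralLinearGroup.scalar (Fin 2) c * A : GL (Fin 2) K).1 = (c : K) • A.1 := by
  rw [Units.val_mul, Matrix.GeneralLinearGroup.coe_scalar]
  ext i j
  simp

theorem ofColumns_eq_iff {v : Valuation K Γ₀} {A B : GL (Fin 2) K} :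
    Vertex.ofColumns v A = Vertex.ofColumns v B ↔
      ∃ c : Kˣ, IsIntegralMatrix v ((c : K) • (B⁻¹ * A : GL (Fin 2) K).1) ∧
        v c ^ 2 * v A.1.det = v B.1.det := by
  have h : Vertex.ofColumns v A = Vertex.ofColumns v B ↔
      ∃ c : Kˣ, Matrix.GeneralLinearGroup.scalar (Fin 2) c • columnLattice v A =
        columnLattice v B := Quotient.eq (r := homothety v)
  rw [h]
  refine exists_congr fun c => ?_
  rw [smul_columnLattice, columnLattice_eq_iff, ← mul_assoc,
    ← Matrix.GeneralLinearGroup.scalar_commute, mul_assoc, coe_scalar_mul, coe_scalar_mul,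
    Matrix.det_smul, map_mul, map_pow, Fintype.card_fin]

end BruhatTits

/-! ### Neighbours of the standard vertex for a discrete valuation -/

namespace BruhatTits

open WithZero

variable {K : Type*} [Field K] {v : Valuation K (WithZero (Multiplicative ℤ))}

theorem lt_one_iff_le_exp_neg_one {x : WithZero (Multiplicative ℤ)} : x < 1 ↔ x ≤ exp (-1 : ℤ) := by
  induction x using WithZero.expRecOn with
  | zero => simp
  | exp a =>
    rw [← exp_zero, exp_lt_exp, exp_le_exp]; lia

theorem residue_eq_zero_iff (x : v.valuationSubring) :
    IsLocalRing.residue v.valuationSubring x = 0 ↔ v (x : K) < 1 := by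
  rw [IsLocalRing.residue_eq_zero_iff, Valuation.mem_maximalIdeal_iff]

theorem mul_lt_one_of_le_of_lt {a b : K} (ha : v a ≤ 1) (hb : v b < 1) : v (a * b) < 1 := by
  rw [map_mul]
  exact mul_lt_one_of_nonneg_of_lt_one_right ha zero_le hb

theorem mul_lt_one_of_lt_of_le {a b : K} (ha : v a < 1) (hb : v b ≤ 1) : v (a * b) < 1 := by
  rw [mul_comm]
  exact mul_lt_one_of_le_of_lt hb ha

/-- If an integral matrix has all entries in the maximal ideal, then its cokernel is not cyclic. -/
theorem exists_entry_eq_one {N : GL (Fin 2) K} (hN : IsIntegralMatrix v N.1) {u : Fin 2 → K}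
    (hu : ∀ i, v (u i) ≤ 1)
    (h : ∀ w : Fin 2 → K, (∀ i, v (w i) ≤ 1) → ∃ c : K, v c ≤ 1 ∧
      w - c • u ∈ (columnLattice v N).1) : ∃ i j, v (N.1 i j) = 1 := by
  by_contra! hne
  have hlt : ∀ i j, v (N.1 i j) < 1 := fun i j => lt_of_le_of_ne (hN i j) (hne i j)
  have hmem : ∀ x ∈ (columnLattice v N).1, ∀ i, v (x i) < 1 := by
    intro x hx i
    rw [mem_columnLattice] at hx
    rw [← mulVec_inv_cancel N x]
    simp only [Matrix.mulVec, dotProduct, Fin.sum_univ_two] at hx ⊢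
    exact v.map_add_lt (mul_lt_one_of_lt_of_le (hlt _ _) (hx _))
      (mul_lt_one_of_lt_of_le (hlt _ _) (hx _))
  obtain ⟨c, hc, hcu⟩ := h ![1, 0] (by intro i; fin_cases i <;> simp)
  obtain ⟨d, hd, hdu⟩ := h ![0, 1] (by intro i; fin_cases i <;> simp)
  have h1 : v (1 - c * u 0) < 1 := by simpa using hmem _ hcu 0
  have h2 : v (c * u 1) < 1 := by simpa using hmem _ hcu 1
  have h3 : v (1 - d * u 1) < 1 := by simpa using hmem _ hdu 1
  -- Modulo the maximal ideal both basis vectors would be multiples of `u`. Then c u₀ = d u₁ = 1 and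
  -- c u₁ = 0, so 1 = (c u₀)(d u₁) = (c u₁)(d u₀) = 0.
  have h4 : v ((1 - c * u 0) + (c * u 0) * (1 - d * u 1) + (c * u 1) * (d * u 0)) < 1 := by
    refine v.map_add_lt (v.map_add_lt h1 (mul_lt_one_of_le_of_lt ?_ h3))
      (mul_lt_one_of_lt_of_le h2 ?_) <;> rw [map_mul]
    · exact mul_le_one' hc (hu 0)
    · exact mul_le_one' hd (hu 0)
  have h5 : (1 - c * u 0) + (c * u 0) * (1 - d * u 1) + (c * u 1) * (d * u 0) = 1 := by ring
  rw [h5, map_one] at h4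
  exact lt_irrefl _ h4

/-- Three properties of the residue field are used for N = B⁻¹A. It is cyclic, so N has a unit
entry; it is nonzero, so det N is not a unit; it is killed by p, so p N⁻¹ is integral. The last says
that v(p) times the valuation of each entry of adj N is at most v(det N), and the unit entry turns
this into v(p) ≤ v(det N). -/
theorem val_det_of_quotient_equiv {p : K} (hp : v p = exp (-1 : ℤ)) {A B : GL (Fin 2) K}
    (hle : (columnLattice v A).1 ≤ (columnLattice v B).1)
    (e : ((columnLattice v B).1 ⧸ (columnLattice v A).1.submoduleOf (columnLattice v B).1)
      ≃ₗ[v.valuationSubring] IsLocalRing.ResidueField v.valuationSubring) :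
    v (B⁻¹ * A : GL (Fin 2) K).1.det = exp (-1 : ℤ) := by
  set N : GL (Fin 2) K := B⁻¹ * A with hNdef
  have hN : IsIntegralMatrix v N.1 := columnLattice_le_iff.1 hle
  have hA : A = B * N := by simp [hNdef]
  have hBN : ∀ x, B.1.mulVec x ∈ (columnLattice v A).1 ↔ x ∈ (columnLattice v N).1 := by
    intro x
    rw [mem_columnLattice, mem_columnLattice, Matrix.mulVec_mulVec, ← Units.val_mul]
    simp [hNdef]
  have hmk : ∀ y : (columnLattice v B).1, y.1 ∈ (columnLattice v A).1 ↔
      e (Submodule.Quotient.mk y) = 0 := by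
    intro y
    rw [LinearEquiv.map_eq_zero_iff, Submodule.Quotient.mk_eq_zero]
    rfl
  obtain ⟨x, hx⟩ := Submodule.Quotient.mk_surjective _ (e.symm 1)
  have hex : e (Submodule.Quotient.mk x) = 1 := by rw [hx, e.apply_symm_apply]
  have hxB := mem_columnLattice.1 x.2
  set u := ((B⁻¹ : GL (Fin 2) K) : Matrix (Fin 2) (Fin 2) K).mulVec x.1 with hu
  have hBu : B.1.mulVec u = x.1 := mulVec_inv_cancel B x.1
  obtain ⟨i, j, hij⟩ := exists_entry_eq_one hN hxB (by
    intro w hw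
    obtain ⟨c, hc⟩ := IsLocalRing.residue_surjective
      (e (Submodule.Quotient.mk ⟨B.1.mulVec w, mulVec_mem_columnLattice.2 hw⟩))
    refine ⟨c, c.2, ?_⟩
    rw [← hBN]
    have := (hmk (⟨B.1.mulVec w, mulVec_mem_columnLattice.2 hw⟩ - c • x)).2 (by
      rw [Submodule.Quotient.mk_sub, Submodule.Quotient.mk_smul, map_sub, map_smul, hex, ← hc,
        Algebra.smul_def, mul_one, sub_eq_zero]
      rfl)
    rw [Matrix.mulVec_sub, Matrix.mulVec_smul, hBu]
    exact this)
  have hpO : v p ≤ 1 := by rw [hp, ← exp_zero, exp_le_exp]; lia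
  have hpN : ∀ w : Fin 2 → K, (∀ i, v (w i) ≤ 1) → p • w ∈ (columnLattice v N).1 := by
    intro w hw
    rw [← hBN, Matrix.mulVec_smul]
    refine (hmk ((⟨p, hpO⟩ : v.valuationSubring) •
      ⟨B.1.mulVec w, mulVec_mem_columnLattice.2 hw⟩)).2 ?_
    rw [Submodule.Quotient.mk_smul, map_smul, Algebra.smul_def,
      IsLocalRing.ResidueField.algebraMap_eq, (residue_eq_zero_iff _).2, zero_mul]
    change v p < 1
    rw [lt_one_iff_le_exp_neg_one, hp]
  have hdet1 : v N.1.det ≠ 1 := by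
    intro h
    have h1 := hN.inv h
    have h2 := (hmk x).1 (by
      rw [← hBu, hBN, mem_columnLattice, val_inv_eq]
      exact h1.mulVec hxB)
    rw [hex] at h2
    exact one_ne_zero h2
  refine le_antisymm (lt_one_iff_le_exp_neg_one.1 (lt_of_le_of_ne hN.det_le_one hdet1)) ?_
  have hinv : ∀ i j, v p * v (N.1.adjugate i j) ≤ v N.1.det := by
    intro i j
    have := mem_columnLattice.1 (hpN (Pi.single j 1) (by
      intro i; by_cases hij : i = j <;> simp [hij])) i
    rw [Matrix.mulVec_smul, val_inv_eq, Matrix.inv_def, Ring.inverse_eq_inv'] at this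
    simp only [Matrix.mulVec_single_one, Matrix.col_apply, Pi.smul_apply, Matrix.smul_apply,
      smul_eq_mul, map_mul, map_inv₀] at this
    rw [mul_left_comm, inv_mul_le_iff₀ (zero_lt_iff.2 (val_det_ne_zero v N)), mul_one] at this
    exact this
  rw [Matrix.adjugate_fin_two] at hinv
  rw [← hp]
  fin_cases i <;> fin_cases j
  · simpa using (congrArg (v p * ·) hij).symm.le.trans (by simpa using hinv 1 1)
  · simpa using (congrArg (v p * ·) hij).symm.le.trans (by simpa using hinv 0 1)
  · simpa using (congrArg (v p * ·) hij).symm.le.trans (by simpa using hinv 1 0)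
  · simpa using (congrArg (v p * ·) hij).symm.le.trans (by simpa using hinv 0 0)

theorem mem_columnLattice_one {x : Fin 2 → K} :
    x ∈ (columnLattice v 1).1 ↔ ∀ i, v (x i) ≤ 1 := by
  simp [mem_columnLattice]

/-- Since det N is a uniformizer, x lies in the lattice of N iff adj(N)x vanishes modulo the maximal
ideal. There adj N has rank one, so one row with a unit entry suffices. -/
theorem exists_functional {N : GL (Fin 2) K} (hN : IsIntegralMatrix v N.1)
    (hdet : v N.1.det = exp (-1 : ℤ)) :
    ∃ r : Fin 2 → K, (∀ i, v (r i) ≤ 1) ∧ (∃ i, v (r i) = 1) ∧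
      ∀ x : Fin 2 → K, (∀ i, v (x i) ≤ 1) →
        (x ∈ (columnLattice v N).1 ↔ v (dotProduct r x) < 1) := by
  have hmem : ∀ x, x ∈ (columnLattice v N).1 ↔ ∀ i, v (N.1.adjugate.mulVec x i) < 1 := by
    intro x
    rw [mem_columnLattice, val_inv_eq, Matrix.inv_def, Ring.inverse_eq_inv']
    refine forall_congr' fun i => ?_
    rw [Matrix.smul_mulVec, Pi.smul_apply, smul_eq_mul, map_mul, map_inv₀,
      inv_mul_le_iff₀ (zero_lt_iff.2 (val_det_ne_zero v N)), mul_one, hdet,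
      lt_one_iff_le_exp_neg_one]
  have hadj := hN.adjugate
  have hdetadj : N.1.adjugate.det = N.1.det := by simp [Matrix.det_adjugate]
  set R := N.1.adjugate with hR
  have hlt : v R.det < 1 := by rw [hdetadj, hdet, lt_one_iff_le_exp_neg_one]
  have hunit : ∃ i j, v (R i j) = 1 := by
    -- If every entry lay in the maximal ideal, the determinant would have valuation at most exp
    -- (-2).
    by_contra! hne
    have h : ∀ i j, v (R i j) ≤ exp (-1 : ℤ) := fun i j =>
      lt_one_iff_le_exp_neg_one.1 (lt_of_le_of_ne (hadj i j) (hne i j))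
    have hmul : ∀ i j i' j', v (R i j * R i' j') ≤ exp (-2 : ℤ) := by
      intro i j i' j'
      rw [map_mul, show (-2 : ℤ) = -1 + -1 by norm_num, exp_add]
      exact mul_le_mul' (h _ _) (h _ _)
    have : v R.det ≤ exp (-2 : ℤ) := by
      rw [Matrix.det_fin_two]
      exact (v.map_sub _ _).trans (max_le (hmul _ _ _ _) (hmul _ _ _ _))
    rw [hdetadj, hdet, exp_le_exp] at this
    lia
  obtain ⟨i, j, hij⟩ := hunit
  refine ⟨R i, hadj i, ⟨j, hij⟩, fun x hx => ?_⟩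
  rw [hmem]
  refine ⟨fun h => h i, fun h i' => ?_⟩
  have hkey : v (R i j * R.mulVec x i') < 1 := by
    -- Eliminating column j between rows i and i' leaves, when i' ≠ i, only ± det R times the
    -- coordinate of x other than the j-th; for i' = i nothing remains.
    obtain ⟨s, hs, y, hy, heq⟩ : ∃ s, v s ≤ 1 ∧ ∃ y, v y ≤ 1 ∧ R i j * R.mulVec x i' =
        s * dotProduct (R i) x + y * R.det := by
      have hneg : ∀ l, v (-x l) ≤ 1 := fun l => by rw [v.map_neg]; exact hx l
      refine ⟨R i' j, hadj _ _, ?_⟩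
      simp only [Matrix.mulVec, dotProduct, Fin.sum_univ_two, Matrix.det_fin_two]
      fin_cases i <;> fin_cases i' <;> fin_cases j <;> dsimp
      · exact ⟨0, by simp, by ring⟩
      · exact ⟨0, by simp, by ring⟩
      · exact ⟨_, hx 1, by ring⟩
      · exact ⟨_, hneg 0, by ring⟩
      · exact ⟨_, hneg 1, by ring⟩
      · exact ⟨_, hx 0, by ring⟩
      · exact ⟨0, by simp, by ring⟩
      · exact ⟨0, by simp, by ring⟩
    rw [heq]
    exact v.map_add_lt (mul_lt_one_of_le_of_lt hs h) (mul_lt_one_of_le_of_lt hy hlt)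
  rwa [map_mul, hij, one_mul] at hkey

/-- The isomorphism is induced by x ↦ r·x modulo the maximal ideal, with r from `exists_functional`;
the unit entry of r gives surjectivity. -/
theorem nonempty_quotient_equiv {N : GL (Fin 2) K} (hN : IsIntegralMatrix v N.1)
    (hdet : v N.1.det = exp (-1 : ℤ)) :
    Nonempty (((columnLattice v 1).1 ⧸ (columnLattice v N).1.submoduleOf (columnLattice v 1).1)
      ≃ₗ[v.valuationSubring] IsLocalRing.ResidueField v.valuationSubring) := by
  obtain ⟨r, hr, ⟨i, hi⟩, h⟩ := exists_functional hN hdet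
  let φ : (columnLattice v 1).1 →ₗ[v.valuationSubring] v.valuationSubring :=
    { toFun := fun x => ⟨dotProduct r x.1, by
        have hx := mem_columnLattice_one.1 x.2
        rw [Valuation.mem_valuationSubring_iff, dotProduct, Fin.sum_univ_two]
        exact map_mul_add_mul_le_one v (hr _) (hx _) (hr _) (hx _)⟩
      map_add' := fun x y => Subtype.ext (dotProduct_add r x.1 y.1)
      map_smul' := fun c x => Subtype.ext (dotProduct_smul (c : K) r x.1) }
  let ψ : (columnLattice v 1).1 →ₗ[v.valuationSubring]
      IsLocalRing.ResidueField v.valuationSubring :=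
    (Algebra.linearMap v.valuationSubring (IsLocalRing.ResidueField v.valuationSubring)).comp φ
  have hker : LinearMap.ker ψ = (columnLattice v N).1.submoduleOf (columnLattice v 1).1 := by
    ext x
    have h1 : x ∈ LinearMap.ker ψ ↔ v (dotProduct r x.1) < 1 := residue_eq_zero_iff (φ x)
    rw [h1, ← h x.1 (mem_columnLattice_one.1 x.2)]
    rfl
  have hsurj : Function.Surjective ψ := by
    intro z
    obtain ⟨c, rfl⟩ := IsLocalRing.residue_surjective z
    have hri : r i ≠ 0 := by
      intro h0
      simp [h0] at hi
    refine ⟨⟨Pi.single i ((r i)⁻¹ * c), mem_columnLattice_one.2 fun j => ?_⟩, ?_⟩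
    · by_cases hij : j = i
      · subst hij
        rw [Pi.single_eq_same, map_mul, map_inv₀, hi, inv_one, one_mul]
        exact c.2
      · simp [hij]
    · refine congrArg (IsLocalRing.residue v.valuationSubring) (Subtype.ext ?_)
      change dotProduct r (Pi.single i ((r i)⁻¹ * (c : K))) = c
      rw [dotProduct_single, mul_inv_cancel_left₀ hri]
  rw [← hker]
  exact ⟨ψ.quotKerEquivOfSurjective hsurj⟩

theorem mk_eq_ofColumns_iff {L : Lattice v} {A : GL (Fin 2) K} :
    Vertex.mk L = Vertex.ofColumns v A ↔
      ∃ c : Kˣ, L = columnLattice v (Matrix.GeneralLinearGroup.scalar (Fin 2) c * A) := by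
  rw [eq_comm]
  refine Iff.trans (Quotient.eq (r := homothety v)) (exists_congr fun c => ?_)
  rw [smul_columnLattice, eq_comm]

/-- Homothety changes the valuation of a determinant by a square, so this parity obstruction shows
that the two ends of an edge are distinct vertices. -/
theorem exp_neg_one_ne_sq (x : WithZero (Multiplicative ℤ)) : x ^ 2 ≠ exp (-1 : ℤ) := by
  induction x using WithZero.expRecOn with
  | zero => rw [zero_pow two_ne_zero]; exact exp_ne_zero.symm
  | exp a =>
    rw [← exp_nsmul, Ne, exp_inj, nsmul_eq_mul]
    push_cast
    lia

theorem tree_adj_ofColumns_one_iff {p : K} (hp : v p = exp (-1 : ℤ)) {g : GL (Fin 2) K} :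
    (tree v).Adj (Vertex.ofColumns v 1) (Vertex.ofColumns v g) ↔
      ∃ c : Kˣ, IsIntegralMatrix v ((c : K) • g.1) ∧ v c ^ 2 * v g.1.det = exp (-1 : ℤ) := by
  have hscal : ∀ a b : Kˣ, (Matrix.GeneralLinearGroup.scalar (Fin 2) a * 1)⁻¹ *
      (Matrix.GeneralLinearGroup.scalar (Fin 2) b * g) =
      Matrix.GeneralLinearGroup.scalar (Fin 2) (a⁻¹ * b) * g := by
    intro a b
    rw [mul_one, map_mul, map_inv, mul_assoc]
  have hdets : ∀ c : Kˣ, v (Matrix.GeneralLinearGroup.scalar (Fin 2) c * g).1.det =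
      v c ^ 2 * v g.1.det := by
    intro c
    rw [coe_scalar_mul, Matrix.det_smul, map_mul, map_pow, Fintype.card_fin]
  rw [tree, SimpleGraph.fromRel_adj]
  constructor
  · rintro ⟨-, ⟨L, L', hL, hL', hle, ⟨e⟩⟩ | ⟨L, L', hL, hL', hle, ⟨e⟩⟩⟩
    · obtain ⟨a, rfl⟩ := mk_eq_ofColumns_iff.1 hL
      obtain ⟨b, rfl⟩ := mk_eq_ofColumns_iff.1 hL'
      have h1 := columnLattice_le_iff.1 hle
      have h2 := val_det_of_quotient_equiv hp hle e
      rw [hscal, hdets] at h2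
      rw [hscal, coe_scalar_mul] at h1
      exact ⟨_, h1, h2⟩
    · obtain ⟨b, rfl⟩ := mk_eq_ofColumns_iff.1 hL
      obtain ⟨a, rfl⟩ := mk_eq_ofColumns_iff.1 hL'
      have h1 := columnLattice_le_iff.1 hle
      have h2 := val_det_of_quotient_equiv hp hle e
      set N := (Matrix.GeneralLinearGroup.scalar (Fin 2) b * g)⁻¹ *
        (Matrix.GeneralLinearGroup.scalar (Fin 2) a * 1) with hNdef
      have hNinv : N⁻¹ = Matrix.GeneralLinearGroup.scalar (Fin 2) (a⁻¹ * b) * g := by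
        rw [← hscal, hNdef, mul_inv_rev, inv_inv]
      -- With the inclusion reversed, N is a scalar times g⁻¹. Its adjugate is a scalar multiple of
      -- g that is again integral, and for 2×2 matrices it has the same determinant as N.
      have hadj : N.1.adjugate = ((Matrix.GeneralLinearGroup.det N * (a⁻¹ * b) : Kˣ) : K) • g.1 := by
        rw [Units.val_mul (Matrix.GeneralLinearGroup.det N), mul_smul, ← coe_scalar_mul, ← hNinv,
          val_inv_eq, Matrix.inv_def, Ring.inverse_eq_inv', smul_smul,
          Matrix.GeneralLinearGroup.val_det_apply, mul_inv_cancel₀ N.det_ne_zero, one_smul]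
      refine ⟨Matrix.GeneralLinearGroup.det N * (a⁻¹ * b), hadj ▸ h1.adjugate, ?_⟩
      rw [← hdets, coe_scalar_mul, ← hadj, Matrix.det_adjugate]
      simpa using h2
  · rintro ⟨c, hc, hdet⟩
    refine ⟨fun h => ?_, Or.inl ⟨columnLattice v 1,
      columnLattice v (Matrix.GeneralLinearGroup.scalar (Fin 2) c * g), rfl,
      mk_eq_ofColumns_iff.2 ⟨c, rfl⟩, ?_, ?_⟩⟩
    · obtain ⟨d, -, hd⟩ := ofColumns_eq_iff.1 h
      rw [Units.val_one, Matrix.det_one, map_one, mul_one] at hd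
      rw [← hd, ← mul_pow] at hdet
      exact exp_neg_one_ne_sq _ hdet
    · rw [columnLattice_le_iff, inv_one, one_mul, coe_scalar_mul]
      exact hc
    · exact nonempty_quotient_equiv (by rw [coe_scalar_mul]; exact hc) (by rw [hdets, hdet])

theorem isIntegralMatrix_smul_congr {K Γ₀ : Type*} [Field K] [LinearOrderedCommGroupWithZero Γ₀]
    {v : Valuation K Γ₀} {a b : K} (h : v a = v b) {A : Matrix (Fin 2) (Fin 2) K} :
    IsIntegralMatrix v (a • A) ↔ IsIntegralMatrix v (b • A) := by
  simp only [IsIntegralMatrix, Matrix.smul_apply, smul_eq_mul, map_mul, h]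

end BruhatTits

/-! ### Descent from the completion to k(t) -/

namespace RationalFunctionField

open BruhatTits WithZero

variable {k : Type*} [Field k]

section Completion

variable {w : Valuation (RatFunc k) (WithZero (Multiplicative ℤ))}

theorem completedVal_toCompletion (x : RatFunc k) :
    completedVal w (toCompletion w x) = w x :=
  Valued.valuedCompletion_apply (K := WithVal w) _

theorem isIntegralMatrix_map_iff {A : Matrix (Fin 2) (Fin 2) (RatFunc k)} :
    IsIntegralMatrix (completedVal w) (A.map (toCompletion w)) ↔ IsIntegralMatrix w A := by
  simp only [IsIntegralMatrix, Matrix.map_apply, completedVal_toCompletion]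

theorem val_map (M : GL (Fin 2) (RatFunc k)) :
    (Matrix.GeneralLinearGroup.map (toCompletion w) M).1 = M.1.map (toCompletion w) := rfl

theorem completedVal_det_map (M : GL (Fin 2) (RatFunc k)) :
    completedVal w (Matrix.GeneralLinearGroup.map (toCompletion w) M).1.det = w M.1.det := by
  rw [val_map, ← completedVal_toCompletion, RingHom.map_det, RingHom.mapMatrix_apply]

theorem mk_smul_vertexOf (g M : GL (Fin 2) (RatFunc k)) :
    (Matrix.ProjGenLinGroup.mk g : PGL(2, RatFunc k)) • vertexOf w M = vertexOf w (g * M) := by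
  rw [vertexOf, vertexOf, map_mul, ← smul_ofColumns]
  rfl

/-- A condition depending only on the valuation of a scalar of the completion can be tested on
scalars of `k(t)`. -/
theorem exists_unit_completion_iff (hw : ∀ j : ℤ, ∃ c : (RatFunc k)ˣ, w c = exp j)
    (A : Matrix (Fin 2) (Fin 2) (RatFunc k)) (x y : WithZero (Multiplicative ℤ)) :
    (∃ c : w.Completionˣ, IsIntegralMatrix (completedVal w) ((c : w.Completion) •
        A.map (toCompletion w)) ∧ completedVal w c ^ 2 * x = y) ↔
      ∃ c : (RatFunc k)ˣ, IsIntegralMatrix w ((c : RatFunc k) • A) ∧ w c ^ 2 * x = y := by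
  have hsmul : ∀ c : RatFunc k, toCompletion w c • A.map (toCompletion w) =
      (c • A).map (toCompletion w) := by
    intro c
    ext i j
    simp
  constructor
  · rintro ⟨c, h1, h2⟩
    have hc0 : completedVal w c ≠ 0 := (completedVal w).ne_zero_iff.2 c.ne_zero
    obtain ⟨d, hd⟩ := hw (log (completedVal w c))
    rw [exp_log hc0, ← completedVal_toCompletion] at hd
    refine ⟨d, ?_, ?_⟩
    · rwa [← isIntegralMatrix_map_iff, ← hsmul, isIntegralMatrix_smul_congr hd]
    · rwa [← completedVal_toCompletion (w := w), hd]
  · rintro ⟨c, h1, h2⟩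
    refine ⟨Units.map (toCompletion w).toMonoidHom c, ?_, ?_⟩
    · change IsIntegralMatrix _ (toCompletion w c • _)
      rwa [hsmul, isIntegralMatrix_map_iff]
    · change completedVal w (toCompletion w c) ^ 2 * x = y
      rwa [completedVal_toCompletion]

theorem vertexOf_eq_iff (hw : ∀ j : ℤ, ∃ c : (RatFunc k)ˣ, w c = exp j)
    {A B : GL (Fin 2) (RatFunc k)} :
    vertexOf w A = vertexOf w B ↔ ∃ c : (RatFunc k)ˣ,
      IsIntegralMatrix w ((c : RatFunc k) • (B⁻¹ * A : GL (Fin 2) (RatFunc k)).1) ∧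
        w c ^ 2 * w A.1.det = w B.1.det := by
  rw [vertexOf, vertexOf, ofColumns_eq_iff, ← exists_unit_completion_iff hw, ← map_inv, ← map_mul,
    val_map, completedVal_det_map, completedVal_det_map]

theorem tree_adj_vertexOf_one_iff (hw : ∀ j : ℤ, ∃ c : (RatFunc k)ˣ, w c = exp j)
    {g : GL (Fin 2) (RatFunc k)} :
    (tree (completedVal w)).Adj (vertexOf w 1) (vertexOf w g) ↔ ∃ c : (RatFunc k)ˣ,
      IsIntegralMatrix w ((c : RatFunc k) • g.1) ∧ w c ^ 2 * w g.1.det = exp (-1 : ℤ) := by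
  obtain ⟨p, hp⟩ := hw (-1)
  rw [← completedVal_toCompletion] at hp
  rw [vertexOf, vertexOf, map_one, tree_adj_ofColumns_one_iff hp, ← exists_unit_completion_iff hw,
    val_map, ← val_map, completedVal_det_map]

end Completion

theorem exists_val_eq_exp_of_uniformizer {w : Valuation (RatFunc k) (WithZero (Multiplicative ℤ))}
    {p : RatFunc k} (hp : w p = exp (-1 : ℤ)) (j : ℤ) : ∃ c : (RatFunc k)ˣ, w c = exp j := by
  have hp0 : p ≠ 0 := by
    rintro rfl
    rw [map_zero] at hp
    exact exp_ne_zero.symm hp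
  refine ⟨Units.mk0 p hp0 ^ (-j), ?_⟩
  rw [Units.val_zpow_eq_zpow_val, Units.val_mk0, map_zpow₀, hp, ← exp_zsmul]
  simp

/-! ### Finite places of k(t) and the divisor of f -/

section Places

variable {f : k[X]} {hf : Irreducible f}

theorem valP_self : valP f hf (algebraMap k[X] (RatFunc k) f) = exp (-1 : ℤ) := by
  rw [valP, HeightOneSpectrum.valuation_of_algebraMap]
  exact HeightOneSpectrum.intValuation_singleton _ hf.ne_zero rfl

theorem valuation_eq_one_of_isUnit (q : HeightOneSpectrum k[X]) {u : k[X]} (hu : IsUnit u) :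
    q.valuation (RatFunc k) (algebraMap k[X] (RatFunc k) u) = 1 := by
  rw [HeightOneSpectrum.valuation_eq_one_iff_notMem]
  exact fun h => q.isPrime.ne_top (Ideal.eq_top_of_isUnit_mem _ h hu)

theorem valuation_self_of_ne {q : HeightOneSpectrum k[X]} (hq : q ≠ place f hf) :
    q.valuation (RatFunc k) (algebraMap k[X] (RatFunc k) f) = 1 := by
  rw [HeightOneSpectrum.valuation_eq_one_iff_notMem]
  intro h
  refine hq (HeightOneSpectrum.ext ?_)
  have hmax : (place f hf).asIdeal.IsMaximal := (place f hf).isPrime.isMaximal (place f hf).ne_bot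
  exact (hmax.eq_of_le q.isPrime.ne_top ((Ideal.span_singleton_le_iff_mem _).2 h)).symm

/-- A polynomial whose divisor is the place of `f` is a constant multiple of `f`. -/
theorem exists_eq_C_mul_of_valuation {a : k[X]}
    (hp : valP f hf (algebraMap k[X] (RatFunc k) a) = exp (-1 : ℤ))
    (hq : ∀ q : HeightOneSpectrum k[X], q ≠ place f hf →
      q.valuation (RatFunc k) (algebraMap k[X] (RatFunc k) a) = 1) :
    ∃ c : kˣ, a = C (c : k) * f := by
  have hF : algebraMap k[X] (RatFunc k) f ≠ 0 := by simpa using hf.ne_zero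
  have hA : algebraMap k[X] (RatFunc k) a ≠ 0 := by
    intro h
    rw [h, map_zero] at hp
    exact exp_ne_zero.symm hp
  have hval : ∀ q : HeightOneSpectrum k[X], q.valuation (RatFunc k)
      (algebraMap k[X] (RatFunc k) a) =
        q.valuation (RatFunc k) (algebraMap k[X] (RatFunc k) f) := by
    intro q
    by_cases h : q = place f hf
    · subst h
      exact hp.trans valP_self.symm
    · rw [hq q h, valuation_self_of_ne h]
  -- Both a/f and f/a have valuation 1 at every finite place, so both are polynomials and a/f is a
  -- constant unit.
  obtain ⟨b, hb⟩ := HeightOneSpectrum.mem_integers_of_valuation_le_one (R := k[X]) (RatFunc k)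
    (algebraMap k[X] (RatFunc k) a / algebraMap k[X] (RatFunc k) f) (fun q => by
      rw [map_div₀, hval, div_self ((Valuation.ne_zero_iff _).2 hF)])
  obtain ⟨b', hb'⟩ := HeightOneSpectrum.mem_integers_of_valuation_le_one (R := k[X]) (RatFunc k)
    (algebraMap k[X] (RatFunc k) f / algebraMap k[X] (RatFunc k) a) (fun q => by
      rw [map_div₀, hval, div_self ((Valuation.ne_zero_iff _).2 hF)])
  have hbb : b * b' = 1 := by
    apply RatFunc.algebraMap_injective k
    rw [map_mul, hb, hb', map_one]
    field_simp
  obtain ⟨c, hc, hcb⟩ := Polynomial.isUnit_iff.1 (IsUnit.of_mul_eq_one _ hbb)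
  refine ⟨hc.unit, RatFunc.algebraMap_injective k ?_⟩
  rw [IsUnit.unit_spec, hcb, map_mul, hb, div_mul_cancel₀ _ hF]

end Places

/-! ### The place ∞ and degree bounds -/

theorem valInfty_algebraMap {a : k[X]} (ha : a ≠ 0) :
    valInfty k (algebraMap k[X] (RatFunc k) a) = exp (a.natDegree : ℤ) := by
  classical
  exact RatFunc.inftyValuation.polynomial k ha

theorem valInfty_X_zpow (j : ℤ) : valInfty k (RatFunc.X ^ j) = exp j := by
  classical
  exact RatFunc.inftyValuation.X_zpow k j

theorem exists_valInfty_eq_exp (j : ℤ) : ∃ c : (RatFunc k)ˣ, valInfty k c = exp j :=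
  ⟨Units.mk0 RatFunc.X RatFunc.X_ne_zero ^ j, by
    rw [Units.val_zpow_eq_zpow_val, Units.val_mk0, valInfty_X_zpow]⟩

theorem valInfty_X_zpow_mul_le_one_iff {c : RatFunc k} {i j : ℤ} (hc : valInfty k c = exp j)
    (a : k[X]) : valInfty k (c * (RatFunc.X ^ i * algebraMap k[X] (RatFunc k) a)) ≤ 1 ↔
      DegLE a ((-(i + j) : ℤ) : ℚ) := by
  by_cases ha : a = 0
  · simp [ha, DegLE]
  · have h : (a.natDegree : ℚ) ≤ ((-(i + j) : ℤ) : ℚ) ↔ (a.natDegree : ℤ) ≤ -(i + j) := by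
      rw [← Int.cast_natCast, Int.cast_le]
    rw [map_mul, map_mul, hc, valInfty_X_zpow, valInfty_algebraMap ha, ← exp_add, ← exp_add,
      ← exp_zero, exp_le_exp, DegLE, imp_iff_right ha, h]
    lia

/-- The matrix `diag(t^i, 1)`. -/
noncomputable def diagX (k : Type*) [Field k] (i : ℕ) : GL (Fin 2) (RatFunc k) :=
  Matrix.GeneralLinearGroup.mkOfDetNeZero
    !![(RatFunc.X : RatFunc k) ^ i, 0; 0, 1] (by simp [RatFunc.X_ne_zero])

theorem val_diagX (i : ℕ) : (diagX k i).1 = !![(RatFunc.X : RatFunc k) ^ i, 0; 0, 1] := rfl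

theorem yVertex_eq (i : ℕ) : yVertex k i = vertexOf (valInfty k) (diagX k i) := rfl

/-- Every entry is kept as a power of t times a polynomial, including the power 0, so that
`valInfty_X_zpow_mul_le_one_iff` applies uniformly to all four. -/
theorem diagX_inv_mul_mul_diagX {g : GL (Fin 2) (RatFunc k)} {α β γ δ : k[X]}
    (hg : g.1 = (!![α, β; γ, δ] : Matrix (Fin 2) (Fin 2) k[X]).map (algebraMap k[X] (RatFunc k)))
    (n m : ℕ) : ((diagX k n)⁻¹ * (g * diagX k m) : GL (Fin 2) (RatFunc k)).1 =
      !![RatFunc.X ^ (m - n : ℤ) * algebraMap k[X] (RatFunc k) α,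
          RatFunc.X ^ (-n : ℤ) * algebraMap k[X] (RatFunc k) β;
        RatFunc.X ^ (m : ℤ) * algebraMap k[X] (RatFunc k) γ,
          RatFunc.X ^ (0 : ℤ) * algebraMap k[X] (RatFunc k) δ] := by
  have hX : (RatFunc.X : RatFunc k) ≠ 0 := RatFunc.X_ne_zero
  rw [Units.val_mul, Units.val_mul, val_inv_eq, val_diagX, val_diagX, hg, Matrix.inv_def,
    Matrix.adjugate_fin_two_of, Matrix.det_fin_two_of, Ring.inverse_eq_inv']
  ext i j
  fin_cases i <;> fin_cases j <;>
    simp [Matrix.mul_apply, Fin.sum_univ_two, zpow_sub₀ hX] <;> field_simp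

/-- A polynomial matrix maps `y_m` to `y_n` iff its entries satisfy degree bounds compatible with
the degree of the determinant. -/
theorem mk_smul_yVertex_eq_iff {g : GL (Fin 2) (RatFunc k)} {α β γ δ : k[X]}
    (hg : g.1 = (!![α, β; γ, δ] : Matrix (Fin 2) (Fin 2) k[X]).map (algebraMap k[X] (RatFunc k)))
    (n m : ℕ) :
    (Matrix.ProjGenLinGroup.mk g : PGL(2, RatFunc k)) • yVertex k m = yVertex k n ↔
      ∃ j : ℤ, DegLE α ((n - m - j : ℤ) : ℚ) ∧ DegLE β ((n - j : ℤ) : ℚ) ∧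
        DegLE γ ((-m - j : ℤ) : ℚ) ∧ DegLE δ ((-j : ℤ) : ℚ) ∧
        2 * j + (α * δ - β * γ).natDegree + m = n := by
  have hdetg : g.1.det = algebraMap k[X] (RatFunc k) (α * δ - β * γ) := by
    rw [hg, Matrix.det_fin_two]; simp
  have hdet0 : α * δ - β * γ ≠ 0 := by
    intro h
    rw [h, map_zero] at hdetg
    exact g.det_ne_zero hdetg
  have hX : ∀ i : ℕ, valInfty k (diagX k i).1.det = exp (i : ℤ) := by
    intro i
    rw [val_diagX, Matrix.det_fin_two_of, mul_one, mul_zero, sub_zero, ← zpow_natCast,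
      valInfty_X_zpow]
  have key : ∀ (c : RatFunc k) (j : ℤ), valInfty k c = exp j →
      ((IsIntegralMatrix (valInfty k) (c • ((diagX k n)⁻¹ * (g * diagX k m)).1) ∧
        valInfty k c ^ 2 * valInfty k (g * diagX k m).1.det = valInfty k (diagX k n).1.det) ↔
      DegLE α ((n - m - j : ℤ) : ℚ) ∧ DegLE β ((n - j : ℤ) : ℚ) ∧
        DegLE γ ((-m - j : ℤ) : ℚ) ∧ DegLE δ ((-j : ℤ) : ℚ) ∧
        2 * j + (α * δ - β * γ).natDegree + m = n) := by
    intro c j hc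
    rw [Units.val_mul g, Matrix.det_mul, map_mul, hX, hX, hdetg, valInfty_algebraMap hdet0, hc,
      ← exp_nsmul, ← exp_add, ← exp_add, exp_inj, diagX_inv_mul_mul_diagX hg]
    simp only [IsIntegralMatrix, Fin.forall_fin_two, Matrix.smul_apply, Matrix.of_apply,
      Matrix.cons_val_zero, Matrix.cons_val_one, smul_eq_mul,
      valInfty_X_zpow_mul_le_one_iff hc, and_assoc]
    rw [show -((m - n : ℤ) + j) = n - m - j by ring, show -(-(n : ℤ) + j) = n - j by ring,
      show -((m : ℤ) + j) = -m - j by ring, show -(0 + j) = -j by ring, nsmul_eq_mul,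
      Nat.cast_ofNat, add_assoc (2 * j)]
  rw [yVertex_eq, yVertex_eq, mk_smul_vertexOf, vertexOf_eq_iff exists_valInfty_eq_exp]
  constructor
  · rintro ⟨c, hc⟩
    have hc0 : valInfty k c ≠ 0 := (Valuation.ne_zero_iff _).2 c.ne_zero
    exact ⟨log (valInfty k c), (key c _ (exp_log hc0).symm).1 hc⟩
  · rintro ⟨j, hj⟩
    obtain ⟨c, hc⟩ := exists_valInfty_eq_exp (k := k) j
    exact ⟨c, (key c j hc).2 hj⟩

/-- The degree bounds force `d + n - m` to be even, where `d > 0` is the degree of the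
determinant. -/
theorem exists_shift_iff_degLE {α β γ δ : k[X]} {d : ℕ} (hd : 0 < d)
    (hdet : (α * δ - β * γ).natDegree = d) (n m : ℕ) :
    (∃ j : ℤ, DegLE α ((n - m - j : ℤ) : ℚ) ∧ DegLE β ((n - j : ℤ) : ℚ) ∧
        DegLE γ ((-m - j : ℤ) : ℚ) ∧ DegLE δ ((-j : ℤ) : ℚ) ∧
        2 * j + (α * δ - β * γ).natDegree + m = n) ↔
      DegLE α ((d + n - m : ℚ) / 2) ∧ DegLE β ((d + n + m : ℚ) / 2) ∧
        DegLE γ ((d - n - m : ℚ) / 2) ∧ DegLE δ ((d - n + m : ℚ) / 2) := by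
  rw [hdet]
  -- The determinant condition forces j = (n - m - d)/2; substituting it gives the symmetric bounds.
  have hbounds : ∀ j : ℤ, 2 * j + d + m = n →
      ((n - m - j : ℤ) : ℚ) = (d + n - m : ℚ) / 2 ∧ ((n - j : ℤ) : ℚ) = (d + n + m : ℚ) / 2 ∧
      ((-m - j : ℤ) : ℚ) = (d - n - m : ℚ) / 2 ∧ ((-j : ℤ) : ℚ) = (d - n + m : ℚ) / 2 := by
    intro j hj
    have hj' : (2 * j + d + m : ℚ) = n := by exact_mod_cast hj
    push_cast
    refine ⟨?_, ?_, ?_, ?_⟩ <;> linarith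
  constructor
  · rintro ⟨j, hα, hβ, hγ, hδ, hj⟩
    obtain ⟨h1, h2, h3, h4⟩ := hbounds j hj
    rw [h1] at hα
    rw [h2] at hβ
    rw [h3] at hγ
    rw [h4] at hδ
    exact ⟨hα, hβ, hγ, hδ⟩
  · rintro ⟨hα, hβ, hγ, hδ⟩
    -- The bounds for α and δ add up to d, as do those for β and γ. A product of degree at least d
    -- therefore attains both of its bounds, and the integral degree of a factor supplies j.
    obtain ⟨j, hj⟩ : ∃ j : ℤ, 2 * j + d + m = n := by
      have hle := natDegree_sub_le (α * δ) (β * γ)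
      rw [hdet, le_max_iff] at hle
      rcases hle with hle | hle
      -- Here d > 0 matters: `natDegree` of 0 is 0, so a vanishing product would contradict `hle`.
      · have h0 : α * δ ≠ 0 := fun h => by simp [h] at hle; lia
        rw [natDegree_mul (left_ne_zero_of_mul h0) (right_ne_zero_of_mul h0)] at hle
        have h1 := hα (left_ne_zero_of_mul h0)
        have h2 := hδ (right_ne_zero_of_mul h0)
        have h3 : (d : ℚ) ≤ α.natDegree + δ.natDegree := by exact_mod_cast hle
        refine ⟨n - m - α.natDegree, ?_⟩
        have h4 : (2 * α.natDegree : ℚ) = d + n - m := by linarith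
        have h5 : (2 * α.natDegree : ℤ) = d + n - m := by exact_mod_cast h4
        lia
      · have h0 : β * γ ≠ 0 := fun h => by simp [h] at hle; lia
        rw [natDegree_mul (left_ne_zero_of_mul h0) (right_ne_zero_of_mul h0)] at hle
        have h1 := hβ (left_ne_zero_of_mul h0)
        have h2 := hγ (right_ne_zero_of_mul h0)
        have h3 : (d : ℚ) ≤ β.natDegree + γ.natDegree := by exact_mod_cast hle
        refine ⟨n - β.natDegree, ?_⟩
        have h4 : (2 * β.natDegree : ℚ) = d + n + m := by linarith
        have h5 : (2 * β.natDegree : ℤ) = d + n + m := by exact_mod_cast h4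
        lia
    obtain ⟨h1, h2, h3, h4⟩ := hbounds j hj
    exact ⟨j, h1 ▸ hα, h2 ▸ hβ, h3 ▸ hγ, h4 ▸ hδ, hj⟩

/-! ### The group Π and neighbours of x₀ -/

section Arithmetic

variable {f : k[X]} {hf : Irreducible f}

theorem xVertex_adj_iff {g : GL (Fin 2) (RatFunc k)} :
    (treeX f hf).Adj (xVertex f hf)
        ((Matrix.ProjGenLinGroup.mk g : PGL(2, RatFunc k)) • xVertex f hf) ↔
      ∃ c : (RatFunc k)ˣ, IsIntegralMatrix (valP f hf) ((c : RatFunc k) • g.1) ∧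
        valP f hf c ^ 2 * valP f hf g.1.det = exp (-1 : ℤ) := by
  rw [xVertex, treeX, mk_smul_vertexOf, mul_one,
    tree_adj_vertexOf_one_iff (exists_val_eq_exp_of_uniformizer valP_self)]

/-- An element of `PGL₂(𝒪_{p,∞})` moving `x₀` to a neighbour is represented by a polynomial matrix
with determinant `λf`. -/
theorem exists_polynomial_matrix {h : PGL(2, RatFunc k)} (hh : h ∈ arithmeticGroup f hf)
    (hadj : (treeX f hf).Adj (xVertex f hf) (h • xVertex f hf)) :
    ∃ (g : GL (Fin 2) (RatFunc k)) (P : Matrix (Fin 2) (Fin 2) k[X]),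
      Matrix.ProjGenLinGroup.mk g = h ∧ g.1 = P.map (algebraMap k[X] (RatFunc k)) ∧
        ∃ c : kˣ, P.det = C (c : k) * f := by
  obtain ⟨z, rfl⟩ := hh
  obtain ⟨g₀, rfl⟩ := Matrix.ProjGenLinGroup.mk_surjective z
  rw [Matrix.ProjGenLinGroup.map_mk] at hadj ⊢
  set g := Matrix.GeneralLinearGroup.map (algebraMap (integersPInfty f hf) (RatFunc k)) g₀ with hg
  have hgint : ∀ q : HeightOneSpectrum k[X], q ≠ place f hf →
      IsIntegralMatrix (q.valuation (RatFunc k)) g.1 := fun q hq i j =>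
    (g₀.1 i j).2 q (by simpa using hq)
  have hginv : ∀ q : HeightOneSpectrum k[X], q ≠ place f hf →
      IsIntegralMatrix (q.valuation (RatFunc k)) (g⁻¹ : GL (Fin 2) (RatFunc k)).1 :=
    fun q hq i j => by
      rw [hg, ← map_inv]
      exact ((g₀⁻¹).1 i j).2 q (by simpa using hq)
  have hgdet : ∀ q : HeightOneSpectrum k[X], q ≠ place f hf →
      q.valuation (RatFunc k) g.1.det = 1 := by
    intro q hq
    refine le_antisymm (hgint q hq).det_le_one ?_
    have := (hginv q hq).det_le_one
    rwa [val_inv_eq, Matrix.det_nonsing_inv, Ring.inverse_eq_inv', map_inv₀,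
      inv_le_one₀ (zero_lt_iff.2 (val_det_ne_zero _ g))] at this
  obtain ⟨c, hc, hdet⟩ := xVertex_adj_iff.1 hadj
  have hF : algebraMap k[X] (RatFunc k) f ≠ 0 := by simpa using hf.ne_zero
  -- The scalar c is controlled only at p. This power of f has the same valuation there and
  -- valuation 1 at all other finite places.
  set s : (RatFunc k)ˣ := Units.mk0 _ hF ^ (-log (valP f hf c)) with hs
  have hsp : valP f hf s = valP f hf c := by
    rw [hs, Units.val_zpow_eq_zpow_val, Units.val_mk0, map_zpow₀, valP_self, ← exp_zsmul,
      smul_eq_mul, neg_mul_neg, mul_one, exp_log ((Valuation.ne_zero_iff _).2 c.ne_zero)]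
  have hsq : ∀ q : HeightOneSpectrum k[X], q ≠ place f hf → q.valuation (RatFunc k) s = 1 := by
    intro q hq
    rw [hs, Units.val_zpow_eq_zpow_val, Units.val_mk0, map_zpow₀, valuation_self_of_ne hq, one_zpow]
  have hentry : ∀ i j, ∃ a : k[X], algebraMap k[X] (RatFunc k) a = s * g.1 i j := by
    intro i j
    refine HeightOneSpectrum.mem_integers_of_valuation_le_one (R := k[X]) (RatFunc k) _ fun q => ?_
    by_cases hq : q = place f hf
    · subst hq
      exact (isIntegralMatrix_smul_congr hsp).2 hc i j
    · rw [map_mul, hsq q hq, one_mul]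
      exact hgint q hq i j
  choose P hP using hentry
  have hPg : (Matrix.GeneralLinearGroup.scalar (Fin 2) s * g).1 =
      (Matrix.of P).map (algebraMap k[X] (RatFunc k)) := by
    rw [coe_scalar_mul]
    ext i j
    exact (hP i j).symm
  have hdetP : algebraMap k[X] (RatFunc k) (Matrix.of P).det = (s : RatFunc k) ^ 2 * g.1.det := by
    rw [RingHom.map_det, RingHom.mapMatrix_apply, ← hPg, coe_scalar_mul, Matrix.det_smul,
      Fintype.card_fin]
  refine ⟨_, Matrix.of P, ?_, hPg, exists_eq_C_mul_of_valuation (hf := hf) ?_ fun q hq => ?_⟩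
  · rw [map_mul, Matrix.ProjGenLinGroup.mk_scalar, one_mul]
  · rw [hdetP, map_mul, map_pow, hsp, hdet]
  · rw [hdetP, map_mul, map_pow, hsq q hq, hgdet q hq, one_pow, one_mul]

/-- The determinant λf has valuation 1 at every finite place except p, so its inverse lies in the
ring and P is invertible over it. -/
theorem mk_mem_arithmeticGroup {g : GL (Fin 2) (RatFunc k)} {P : Matrix (Fin 2) (Fin 2) k[X]}
    (hg : g.1 = P.map (algebraMap k[X] (RatFunc k))) {c : kˣ} (hP : P.det = C (c : k) * f) :
    Matrix.ProjGenLinGroup.mk g ∈ arithmeticGroup f hf := by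
  have hdet0 : algebraMap k[X] (RatFunc k) P.det ≠ 0 := by
    simpa [hP] using hf.ne_zero
  have hmem : (algebraMap k[X] (RatFunc k) P.det)⁻¹ ∈ integersPInfty f hf := by
    intro q hq
    rw [map_inv₀, hP, map_mul, map_mul, valuation_self_of_ne (hf := hf) (by simpa using hq),
      valuation_eq_one_of_isUnit q (isUnit_C.2 c.isUnit), one_mul, inv_one]
  have hunit : IsUnit (P.map (algebraMap k[X] (integersPInfty f hf))).det := by
    rw [← RingHom.mapMatrix_apply, ← RingHom.map_det]
    exact IsUnit.of_mul_eq_one ⟨_, hmem⟩ (Subtype.ext (mul_inv_cancel₀ hdet0))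
  refine ⟨Matrix.ProjGenLinGroup.mk (Matrix.GeneralLinearGroup.mk'' _ hunit), ?_⟩
  rw [Matrix.ProjGenLinGroup.map_mk]
  refine congrArg _ (Units.ext ?_)
  rw [hg]
  rfl

/-- No rescaling is needed: polynomial entries are integral at p, and λf is a uniformizer there. -/
theorem xVertex_adj_of_polynomial_matrix {g : GL (Fin 2) (RatFunc k)}
    {P : Matrix (Fin 2) (Fin 2) k[X]} (hg : g.1 = P.map (algebraMap k[X] (RatFunc k))) {c : kˣ}
    (hP : P.det = C (c : k) * f) :
    (treeX f hf).Adj (xVertex f hf)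
      ((Matrix.ProjGenLinGroup.mk g : PGL(2, RatFunc k)) • xVertex f hf) := by
  refine xVertex_adj_iff.2 ⟨1, ?_, ?_⟩
  · rw [Units.val_one, one_smul, hg]
    exact fun i j => HeightOneSpectrum.valuation_le_one _ _
  · rw [Units.val_one, map_one, one_pow, one_mul, hg, ← RingHom.mapMatrix_apply,
      ← RingHom.map_det, hP, map_mul, map_mul, valP_self,
      valuation_eq_one_of_isUnit _ (isUnit_C.2 c.isUnit), one_mul]

end Arithmetic

end RationalFunctionField

open BruhatTits RationalFunctionField in
theorem mainTheorem3 {k : Type*} [Field k] [Finite k] (f : k[X]) (hf : Irreducible f)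
    (hmonic : f.Monic) (n m : ℕ) :
    {h : PGL(2, RatFunc k) | h ∈ arithmeticGroup f hf ∧
      (treeX f hf).Adj (xVertex f hf) (h • xVertex f hf) ∧ h • yVertex k m = yVertex k n} = Upsilon f n m := by
  have hdeg : ∀ {α β γ δ : k[X]} {c : kˣ}, α * δ - β * γ = C (c : k) * f →
      (α * δ - β * γ).natDegree = f.natDegree := fun h => by
    rw [h, natDegree_C_mul (Units.ne_zero _)]
  ext h
  constructor
  · rintro ⟨hh, hadj, hy⟩
    obtain ⟨g, P, rfl, hg, c, hP⟩ := exists_polynomial_matrix hh hadj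
    rw [Matrix.eta_fin_two P] at hg
    rw [Matrix.det_fin_two] at hP
    obtain ⟨hα, hβ, hγ, hδ⟩ := (exists_shift_iff_degLE hf.natDegree_pos (hdeg hP) n m).1
      ((mk_smul_yVertex_eq_iff hg n m).1 hy)
    exact ⟨g, _, _, _, _, rfl, hg, hα, hβ, hγ, hδ, c, hP⟩
  · rintro ⟨g, α, β, γ, δ, rfl, hg, hα, hβ, hγ, hδ, c, hc⟩
    have hP : (!![α, β; γ, δ] : Matrix (Fin 2) (Fin 2) k[X]).det = C (c : k) * f := by
      rw [Matrix.det_fin_two_of, hc]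
    exact ⟨mk_mem_arithmeticGroup hg hP, xVertex_adj_of_polynomial_matrix hg hP,
      (mk_smul_yVertex_eq_iff hg n m).2 ((exists_shift_iff_degLE hf.natDegree_pos (hdeg hc) n m).2
        ⟨hα, hβ, hγ, hδ⟩)⟩
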